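/- Call an action of a group $\Gamma$ on a set $X$ amenable if there is a finitely additive $\Gamma$-invariant probability measure defined on all subsets of $X$. A group $\Gamma$ is amenable if its action on itself by left multiplication is amenable, and inner amenable if its action on $\Gamma\setminus\{e\}$ by conjugation is amenable. A group is ICC if all its nontrivial conjugacy classes are infinite. Two groups are elementarily equivalent if they satisfy the same first-order sentences in the language of groups. There exist elementarily equivalent countable ICC groups $G$ and $H$ such that $G$ is amenable and $H$ is not inner amenable. Concretely, let $K=\mathbb F_2^{\mathrm{alg}}$ be the algebraic closure of the field with two elements. Then $\operatorname{SL}_2(K)$ is a countable amenable ICC group. For every algebraically closed field $L$ of characteristic $2$ and positive transcendence degree over $\mathbb F_2$, the group $\operatorname{SL}_2(L)$ is ICC, is elementarily equivalent to $\operatorname{SL}_2(K)$, and is not inner amenable; if $L$ is countable, then so is $\operatorname{SL}_2(L)$. The field $L=\mathbb F_2(t)^{\mathrm{alg}}$, where $t$ is an indeterminate, is countable, algebraically closed, of characteristic $2$ and of positive transcendence degree over $\mathbb F_2$, so that $G=\operatorname{SL}_2(K)$ and $H=\operatorname{SL}_2(\mathbb F_2(t)^{\mathrm{alg}})$ are groups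 as required. -/

import Mathlib

open Set
open scoped NNReal FirstOrder MatrixGroups

/-- The function symbols of the language of groups: multiplication, inversion and the identity. -/
inductive GroupFunc : ℕ → Type
  | mul : GroupFunc 2
  | inv : GroupFunc 1
  | one : GroupFunc 0

/-- The first-order language of groups `(·, ⁻¹, 1)`. -/
def groupLanguage : FirstOrder.Language where
  Functions := GroupFunc
  Relations := fun _ => Empty

/-- Every group is a structure in the language of groups, with the usual interpretation. -/
instance groupStructure (G : Type*) [Group G] : groupLanguage.Structure G where
  funMap := fun {n} (f : GroupFunc n) =>
    match n, f with
    | _, .mul => fun x => x 0 * x 1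
    | _, .inv => fun x => (x 0)⁻¹
    | _, .one => fun _ => 1
  RelMap := fun r => nomatch r

/-- An action of `G` on `X` is amenable if there is a finitely additive `G`-invariant probability
measure defined on all subsets of `X`. -/
def IsAmenableAction (G X : Type*) [Group G] [MulAction G X] : Prop :=
  ∃ μ : Set X → ℝ≥0, μ univ = 1 ∧
    (∀ A B : Set X, Disjoint A B → μ (A ∪ B) = μ A + μ B) ∧
    ∀ (g : G) (A : Set X), μ ((fun x => g • x) '' A) = μ A

/-- A group is amenable if its action on itself by left multiplication is amenable. -/
def IsAmenable (G : Type*) [Group G] : Prop :=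
  IsAmenableAction G G

/-- The set `G \ {1}` with the conjugation action of `G`. -/
def nontrivialElements (G : Type*) [Group G] : SubMulAction (ConjAct G) G where
  carrier := {1}ᶜ
  smul_mem' := by
    intro c x hx
    simpa [ConjAct.smul_def, mul_inv_eq_one] using hx

/-- A group is inner amenable if its action by conjugation on `G \ {1}` is amenable. -/
def IsInnerAmenable (G : Type*) [Group G] : Prop :=
  IsAmenableAction (ConjAct G) (nontrivialElements G)

/-- A group is ICC if all its nontrivial conjugacy classes are infinite. -/
def IsICC (G : Type*) [Group G] : Prop :=
  ∀ g : G, g ≠ 1 → (conjugatesOf g).Infinite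

/-! ### Interpreting `SL₂` of a field in the language of rings -/

/-! Elementary equivalence: `SL₂` is interpreted in its field by formulas independent of the field,
and the theory of algebraically closed fields of characteristic 2 is complete. Over an algebraic
extension of `𝔽₂` the group is locally finite, hence amenable.

Failure of inner amenability is a ping-pong argument on the projective line of `L`. A transcendental
element yields a valuation with `v t > 1`. Over an algebraically closed field every element of `SL₂`
fixes a point. Conjugation by `diag(t, t⁻¹)` moves fixed points outside the residue disc of `0` into
the disc at infinity, so almost every element fixes a point in one of these two discs
(`ConjMean.fixesNearInfty_union_fixesNear_zero`). Translating `0` to three points in distinct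
residue discs, almost every element fixes a point near infinity or one in each of three disjoint
discs; the latter forces the identity, which is null. So almost every element fixes a point near
infinity, by conjugation also near each of the three points, and the identity would have full mass.
-/

open FirstOrder FirstOrder.Language FirstOrder.Ring in
/-- The entries of the interpretation of a group operation on `2 × 2` matrices of ring terms. -/
def matrixOp {β : Type} : {n : ℕ} → GroupFunc n →
    (Fin n → Fin 2 → Fin 2 → Language.ring.Term β) → Fin 2 → Fin 2 → Language.ring.Term β
  | _, .mul, x => fun i j => x 0 i 0 * x 1 0 j + x 0 i 1 * x 1 1 j
  | _, .inv, x => !![x 0 1 1, -x 0 0 1; -x 0 1 0, x 0 0 0]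
  | _, .one, _ => !![1, 0; 0, 1]

/-- The ring terms for the entries of a group term evaluated at `2 × 2` matrices. -/
def entryTerm {α : Type} : groupLanguage.Term α →
    Fin 2 → Fin 2 → FirstOrder.Language.ring.Term (α × Fin 2 × Fin 2)
  | .var a => fun i j => .var (a, i, j)
  | .func f ts => matrixOp f fun k => entryTerm (ts k)

/-- Separates the entries of the last bound variable from those of the other variables. -/
def splitLast {α : Type} {n : ℕ} :
    (α ⊕ Fin (n + 1)) × Fin 2 × Fin 2 → ((α ⊕ Fin n) × Fin 2 × Fin 2) ⊕ (Fin 2 × Fin 2)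
  | (.inl a, i) => .inl (.inl a, i)
  | (.inr k, i) => Fin.lastCases (.inr i) (fun k => .inl (.inr k, i)) k

open FirstOrder FirstOrder.Language FirstOrder.Ring in
/-- The formula saying that a `2 × 2` matrix of variables has determinant one. -/
def detOneFormula {β : Type} : Language.ring.Formula (β ⊕ (Fin 2 × Fin 2)) :=
  Term.equal (.var (.inr (0, 0)) * .var (.inr (1, 1)) +
    -(.var (.inr (0, 1)) * .var (.inr (1, 0)))) 1

open FirstOrder FirstOrder.Language in
/-- Translates a formula about `SL₂` of a field into a formula about the field. -/
noncomputable def fieldFormula {α : Type} : {n : ℕ} → groupLanguage.BoundedFormula α n →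
    Language.ring.Formula ((α ⊕ Fin n) × Fin 2 × Fin 2)
  | _, .falsum => ⊥
  | _, .equal t s =>
      (Term.equal (entryTerm t 0 0) (entryTerm s 0 0) ⊓
        Term.equal (entryTerm t 0 1) (entryTerm s 0 1)) ⊓
      (Term.equal (entryTerm t 1 0) (entryTerm s 1 0) ⊓
        Term.equal (entryTerm t 1 1) (entryTerm s 1 1))
  | _, .rel R _ => nomatch R
  | _, .imp φ ψ => (fieldFormula φ).imp (fieldFormula ψ)
  | _, .all φ => Formula.iAlls (Fin 2 × Fin 2)
      (detOneFormula.imp ((fieldFormula φ).relabel splitLast))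

section Translation

open FirstOrder FirstOrder.Language FirstOrder.Ring

variable {F : Type*} [Field F] [CompatibleRing F]

theorem realize_entryTerm {α : Type} (v : α → SL(2, F)) (t : groupLanguage.Term α) (i j : Fin 2) :
    (entryTerm t i j).realize (fun a : α × Fin 2 × Fin 2 => (v a.1).1 a.2.1 a.2.2) =
      (t.realize v).1 i j := by
  induction t generalizing i j with
  | var a => rfl
  | func f ts ih =>
    cases f with
    | mul =>
      change _ = ((ts 0).realize v * (ts 1).realize v).1 i j
      simp [entryTerm, matrixOp, ih, Matrix.mul_apply, Fin.sum_univ_two]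
    | inv =>
      change _ = (((ts 0).realize v)⁻¹).1 i j
      -- Determinant one makes inversion polynomial: the inverse is the adjugate.
      rw [Matrix.SpecialLinearGroup.coe_inv, Matrix.adjugate_fin_two]
      fin_cases i <;> fin_cases j <;> simp [entryTerm, matrixOp, ih]
    | one =>
      change _ = (1 : SL(2, F)).1 i j
      fin_cases i <;> fin_cases j <;> simp [entryTerm, matrixOp]

theorem realize_fieldFormula {α : Type} {n : ℕ} (φ : groupLanguage.BoundedFormula α n)
    (v : α → SL(2, F)) (w : Fin n → SL(2, F)) :
    (fieldFormula φ).Realize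
        (fun a : (α ⊕ Fin n) × Fin 2 × Fin 2 => (Sum.elim v w a.1).1 a.2.1 a.2.2) ↔
      φ.Realize v w := by
  induction φ with
  | falsum => rfl
  | equal t s =>
    simp only [fieldFormula, Formula.realize_inf, Formula.realize_equal, realize_entryTerm,
      BoundedFormula.Realize]
    constructor
    · rintro ⟨⟨h1, h2⟩, h3, h4⟩
      ext i j
      fin_cases i <;> fin_cases j <;> assumption
    · intro h
      simp [h]
  | rel R => exact nomatch R
  | imp φ ψ ih₁ ih₂ =>
    simp only [fieldFormula, Formula.realize_imp, ih₁, ih₂, BoundedFormula.realize_imp]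
  | @all n φ ih =>
    simp only [fieldFormula, Formula.realize_iAlls, Formula.realize_imp, Formula.realize_relabel,
      BoundedFormula.realize_all]
    -- A group quantifier becomes four field quantifiers guarded by the determinant; `key` matches a
    -- tuple `m` with the matrix `x` it encodes.
    have key : ∀ (m : Fin 2 × Fin 2 → F) (x : SL(2, F)), (∀ i j, m (i, j) = x.1 i j) →
        (((fieldFormula φ).Realize
          ((fun a => Sum.elim (fun a : (α ⊕ Fin n) × Fin 2 × Fin 2 =>
            (Sum.elim v w a.1).1 a.2.1 a.2.2) m a) ∘ splitLast)) ↔ φ.Realize v (Fin.snoc w x)) := by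
      intro m x hx
      rw [← ih]
      apply iff_of_eq
      congr 1
      funext ⟨a, i, j⟩
      rcases a with a | k
      · rfl
      · refine Fin.lastCases ?_ (fun k => ?_) k <;> simp [splitLast, hx]
    constructor
    · intro h x
      refine (key (fun p => x.1 p.1 p.2) x fun _ _ => rfl).1 (h _ ?_)
      have := x.2
      rw [Matrix.det_fin_two] at this
      simpa [detOneFormula, ← sub_eq_add_neg] using this
    · intro h m hm
      refine (key m ⟨!![m (0, 0), m (0, 1); m (1, 0), m (1, 1)], ?_⟩ ?_).2 (h _)
      · simpa [detOneFormula, Matrix.det_fin_two, ← sub_eq_add_neg] using hm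
      · intro i j
        fin_cases i <;> fin_cases j <;> rfl

/-- Translates a sentence about `SL₂` of a field into a sentence about the field. -/
noncomputable def fieldSentence (φ : groupLanguage.Sentence) : Language.ring.Sentence :=
  (fieldFormula φ).relabel fun a => a.1.elim id Fin.elim0

variable (F) in
theorem realize_fieldSentence (φ : groupLanguage.Sentence) :
    F ⊨ fieldSentence φ ↔ SL(2, F) ⊨ φ := by
  rw [Sentence.Realize, Sentence.Realize, fieldSentence, Formula.realize_relabel, Formula.Realize,
    Formula.Realize, ← realize_fieldFormula]
  apply iff_of_eq
  unfold Formula.Realize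
  congr 1
  funext ⟨a, _⟩
  rcases a with a | a
  · exact a.elim
  · exact a.elim0

end Translation

open FirstOrder FirstOrder.Language FirstOrder.Ring in
/-- `SL₂` of algebraically closed fields of the same prime characteristic are elementarily
equivalent. -/
theorem elementarilyEquivalent_SL2 (p : ℕ) [hp : Fact p.Prime] (K L : Type*) [Field K] [Field L]
    [IsAlgClosed K] [IsAlgClosed L] [CharP K p] [CharP L p] :
    SL(2, K) ≅[groupLanguage] SL(2, L) := by
  let _ := compatibleRingOfRing K
  let _ := compatibleRingOfRing L
  rw [elementarilyEquivalent_iff]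
  intro φ
  rw [← realize_fieldSentence K, ← realize_fieldSentence L]
  have hc := Field.ACF_isComplete (p := p) (.inl hp.out)
  exact (hc.realize_sentence_iff (fieldSentence φ) K).trans (hc.realize_sentence_iff (fieldSentence φ) L).symm

/-! ### Conjugacy classes in `SL₂` -/

section Unipotent

variable {R : Type*} [CommRing R]

/-- The upper unitriangular matrix with entry `a`. -/
def upperUnipotent (a : R) : SL(2, R) := ⟨!![1, a; 0, 1], by simp⟩

/-- The lower unitriangular matrix with entry `a`. -/
def lowerUnipotent (a : R) : SL(2, R) := ⟨!![1, 0; a, 1], by simp⟩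

@[simp]
theorem coe_upperUnipotent (a : R) :
    (upperUnipotent a : Matrix (Fin 2) (Fin 2) R) = !![1, a; 0, 1] := rfl

@[simp]
theorem coe_lowerUnipotent (a : R) :
    (lowerUnipotent a : Matrix (Fin 2) (Fin 2) R) = !![1, 0; a, 1] := rfl

end Unipotent

/-- In characteristic two, `a² = 1` gives `(a - 1)² = 0`, so no nontrivial scalar has determinant
one. -/
theorem SL2_eq_one_of_scalar {L : Type*} [Field L] [CharP L 2] {g : SL(2, L)}
    (hb : g.1 0 1 = 0) (hc : g.1 1 0 = 0) (hd : g.1 0 0 = g.1 1 1) : g = 1 := by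
  have h := g.2
  rw [Matrix.det_fin_two, hb, ← hd] at h
  have h2 : (2 : L) = 0 := CharTwo.two_eq_zero
  have h1 : g.1 0 0 = 1 := by
    have : (g.1 0 0 - 1) ^ 2 = 0 := by linear_combination h + (1 - g.1 0 0) * h2
    exact sub_eq_zero.1 (pow_eq_zero_iff two_ne_zero |>.1 this)
  ext i j
  fin_cases i <;> fin_cases j <;> simp_all

/-- `SL₂` of an infinite field of characteristic two is ICC. -/
theorem isICC_SL2 (L : Type*) [Field L] [CharP L 2] [Infinite L] : IsICC SL(2, L) := by
  intro g hg
  -- In each case some entry of the conjugate is affine in the unipotent parameter `z`, with nonzero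
  -- slope `d - a`, `b` or `c`.
  have key : ∀ f : L → SL(2, L), Function.Injective (fun z => f z * g * (f z)⁻¹) →
      (conjugatesOf g).Infinite := fun f hf =>
    Set.infinite_of_injective_forall_mem hf fun z => isConj_iff.2 ⟨f z, rfl⟩
  by_cases hc : g.1 1 0 = 0
  · by_cases hb : g.1 0 1 = 0
    · have hd : g.1 1 1 - g.1 0 0 ≠ 0 := fun h =>
        hg (SL2_eq_one_of_scalar hb hc (sub_eq_zero.1 h).symm)
      refine key upperUnipotent fun z w h => ?_
      have := congrFun₂ (congrArg Subtype.val h) 0 1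
      simp [Matrix.adjugate_fin_two, Matrix.mul_apply, Fin.sum_univ_two,
        Matrix.vecMul, dotProduct, hb, hc] at this
      exact mul_right_cancel₀ hd (by linear_combination this)
    · refine key lowerUnipotent fun z w h => ?_
      have := congrFun₂ (congrArg Subtype.val h) 1 1
      simp [Matrix.adjugate_fin_two, Matrix.mul_apply, Fin.sum_univ_two,
        Matrix.vecMul, dotProduct, hc] at this
      exact this.resolve_right hb
  · refine key upperUnipotent fun z w h => ?_
    have := congrFun₂ (congrArg Subtype.val h) 0 0
    simp [Matrix.adjugate_fin_two, Matrix.mul_apply, Fin.sum_univ_two,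
      Matrix.vecMul, dotProduct] at this
    exact this.resolve_right hc

/-! ### Amenability of locally finite groups -/

open Filter Topology in
/-- A group all of whose finitely generated subgroups are finite is amenable. -/
theorem isAmenable_of_locallyFinite (G : Type*) [Group G]
    (h : ∀ s : Finset G, Finite (Subgroup.closure (s : Set G))) : IsAmenable G := by
  classical
  let H (s : Finset G) : Set G := Subgroup.closure (s : Set G)
  have hfin : ∀ s, (H s).Finite := fun s => Set.finite_coe_iff.1 (h s)
  have hpos : ∀ s, ((H s).ncard : ℝ≥0) ≠ 0 := fun s =>
    Nat.cast_ne_zero.2 ((Set.ncard_pos (hfin s)).2 ⟨1, one_mem _⟩).ne'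
  let m (s : Finset G) (A : Set G) : ℝ≥0 := (A ∩ H s).ncard / (H s).ncard
  have hm : ∀ s A, m s A ≤ 1 := fun s A =>
    div_le_one_of_le₀ (by exact_mod_cast Set.ncard_le_ncard inter_subset_right (hfin s)) (by simp)
  -- The mean is an ultralimit of the uniform measures on the finite subgroups `H s`. Refining
  -- `atTop` ensures that `s` eventually contains any given element.
  let U : Ultrafilter (Finset G) := Ultrafilter.of atTop
  have hU : (U : Filter (Finset G)) ≤ atTop := Ultrafilter.of_le _
  have hlim : ∀ A, ∃ x : ℝ≥0, Tendsto (fun s => m s A) U (𝓝 x) := by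
    intro A
    obtain ⟨x, -, hx⟩ := (isCompact_Icc (a := (0 : ℝ≥0)) (b := 1)).ultrafilter_le_nhds
      (U.map fun s => m s A) (le_principal_iff.2 (Filter.mem_map.2 (univ_mem' fun s => ⟨zero_le, hm s A⟩)))
    exact ⟨x, hx⟩
  choose μ hμ using hlim
  refine ⟨μ, ?_, ?_, ?_⟩
  · refine tendsto_nhds_unique (hμ univ) ?_
    have : (fun s => m s univ) = fun _ => 1 := by
      funext s
      simp only [m, univ_inter]
      exact div_self (hpos s)
    rw [this]
    exact tendsto_const_nhds
  · intro A B hAB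
    refine tendsto_nhds_unique (hμ (A ∪ B)) (((hμ A).add (hμ B)).congr fun s => ?_)
    simp only [m]
    rw [← add_div, ← Nat.cast_add, union_inter_distrib_right, Set.ncard_union_eq
      (hAB.mono inter_subset_left inter_subset_left)
      ((hfin s).subset inter_subset_right) ((hfin s).subset inter_subset_right)]
  · intro g A
    refine tendsto_nhds_unique (hμ _) ((hμ A).congr' ?_)
    filter_upwards [hU (mem_atTop {g})] with s hs
    have hg : g ∈ Subgroup.closure (s : Set G) :=
      Subgroup.subset_closure (by simpa using hs (Finset.mem_singleton_self g))
    have : (fun x => g • x) '' A ∩ H s = (fun x => g • x) '' (A ∩ H s) := by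
      ext x
      constructor
      · rintro ⟨⟨y, hy, rfl⟩, hx⟩
        exact ⟨y, ⟨hy, (Subgroup.mul_mem_cancel_left _ hg).1 hx⟩, rfl⟩
      · rintro ⟨y, ⟨hy, hx⟩, rfl⟩
        exact ⟨⟨y, hy, rfl⟩, (Subgroup.mul_mem_cancel_left _ hg).2 hx⟩
    simp only [m]
    rw [this, Set.ncard_image_of_injective _ (MulAction.injective g)]

/-- `SL₂` of an algebraic extension of a finite field is amenable. -/
theorem isAmenable_SL2_of_isAlgebraic (F K : Type*) [Field F] [Finite F] [Field K] [Algebra F K]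
    [Algebra.IsAlgebraic F K] : IsAmenable SL(2, K) := by
  refine isAmenable_of_locallyFinite _ fun s => ?_
  -- All entries of the generators lie in one finite subfield `M`, so the closure lies in the image
  -- of the finite group `SL(2, M)`.
  let E : Set K := ⋃ g ∈ s, Set.range fun p : Fin 2 × Fin 2 => g.1 p.1 p.2
  have hE : E.Finite := s.finite_toSet.biUnion fun g _ => Set.finite_range _
  let M : IntermediateField F K := IntermediateField.adjoin F E
  have : Finite E := hE
  have : FiniteDimensional F M :=
    IntermediateField.finiteDimensional_adjoin fun x _ => Algebra.IsIntegral.isIntegral x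
  have : Finite M := Module.finite_of_finite F
  let f : SL(2, M) →* SL(2, K) := Matrix.SpecialLinearGroup.map (algebraMap M K)
  have hle : Subgroup.closure (s : Set SL(2, K)) ≤ f.range := by
    rw [Subgroup.closure_le]
    intro g hg
    have hmem : ∀ i j, g.1 i j ∈ M := fun i j =>
      IntermediateField.subset_adjoin F E (Set.mem_biUnion hg ⟨(i, j), rfl⟩)
    refine ⟨⟨Matrix.of fun i j => ⟨g.1 i j, hmem i j⟩, ?_⟩, ?_⟩
    · apply (algebraMap M K).injective
      rw [RingHom.map_det, map_one]
      exact g.2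
    · ext i j
      rfl
  have : Finite f.range := Set.finite_range f
  exact Set.Finite.subset (Set.finite_range f) hle

/-! ### Conjugation-invariant means -/

/-- A finitely additive probability measure on a group, invariant under conjugation and giving the
identity mass zero. -/
structure ConjMean {G : Type*} [Group G] (ν : Set G → ℝ≥0) : Prop where
  univ : ν univ = 1
  union : ∀ A B : Set G, Disjoint A B → ν (A ∪ B) = ν A + ν B
  one : ν {1} = 0
  conj : ∀ (g : G) (A : Set G), ν ((fun x => g * x * g⁻¹) ⁻¹' A) = ν A

/-- The mean is extended to the whole group by giving the identity mass zero. -/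
theorem IsInnerAmenable.exists_conjMean {G : Type*} [Group G] (h : IsInnerAmenable G) :
    ∃ ν : Set G → ℝ≥0, ConjMean ν := by
  obtain ⟨μ, h1, h2, h3⟩ := h
  refine ⟨fun A => μ (Subtype.val ⁻¹' A), h1, fun A B hAB => h2 _ _ (hAB.preimage _), ?_, ?_⟩
  · have : (Subtype.val ⁻¹' {1} : Set (nontrivialElements G)) = ∅ := by
      ext x
      simpa using show (x : G) ≠ 1 from x.2
    have h0 := h2 ∅ ∅ (by simp)
    simp only [this]
    simpa using h0
  · intro g A
    rw [← h3 (ConjAct.toConjAct g)]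
    congr 1
    ext x
    rw [Set.mem_image]
    constructor
    · rintro ⟨y, hy, rfl⟩
      simpa [ConjAct.smul_def] using hy
    · intro hx
      refine ⟨(ConjAct.toConjAct g)⁻¹ • x, ?_, smul_inv_smul _ _⟩
      simpa [ConjAct.smul_def, mul_assoc] using hx

namespace ConjMean

variable {G : Type*} [Group G] {ν : Set G → ℝ≥0} (hν : ConjMean ν)
include hν

theorem mono {A B : Set G} (h : A ⊆ B) : ν A ≤ ν B := by
  rw [← union_sdiff_cancel h, hν.union _ _ disjoint_sdiff_right]
  exact le_self_add

theorem le_one (A : Set G) : ν A ≤ 1 := hν.univ ▸ hν.mono (subset_univ A)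

theorem compl (A : Set G) : ν A + ν Aᶜ = 1 := by
  rw [← hν.union _ _ disjoint_compl_right, union_compl_self, hν.univ]

theorem eq_one_of_subset {A B : Set G} (hA : ν A = 1) (h : A ⊆ B) : ν B = 1 :=
  le_antisymm (hν.le_one B) (hA ▸ hν.mono h)

theorem le_of_conj (g : G) {A B : Set G} (h : ∀ x ∈ A, g * x * g⁻¹ ∈ B) : ν A ≤ ν B :=
  hν.conj g B ▸ hν.mono h

theorem eq_one_of_conj (g : G) {A B : Set G} (hA : ν A = 1) (h : ∀ x ∈ A, g * x * g⁻¹ ∈ B) :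
    ν B = 1 :=
  le_antisymm (hν.le_one B) (hA ▸ hν.le_of_conj g h)

theorem inter {A B : Set G} (hA : ν A = 1) (hB : ν B = 1) : ν (A ∩ B) = 1 := by
  have h1 := hν.compl A
  rw [hA, add_eq_left] at h1
  have h2 : ν (B \ A) = 0 := le_antisymm (h1 ▸ hν.mono fun x hx => hx.2) zero_le
  have h3 := hν.union (B ∩ A) (B \ A) (disjoint_sdiff_right.mono_left inter_subset_right)
  rw [inter_union_sdiff, hB, h2, add_zero] at h3
  rw [inter_comm, ← h3]

theorem eq_one_of_union_one {A : Set G} (hA : ν (A ∪ {1}) = 1) : ν A = 1 := by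
  refine le_antisymm (hν.le_one A) ?_
  have h := hν.union (A \ {1}) {1} disjoint_sdiff_left
  rw [sdiff_union_self, hA, hν.one, add_zero] at h
  exact h ▸ hν.mono sdiff_subset

end ConjMean

/-! ### Fixed points of `SL₂` on the projective line -/

/-- The quadratic form vanishing at the eigenvectors of a `2 × 2` matrix. -/
def eigenForm {L : Type*} [Field L] (x : SL(2, L)) (p q : L) : L :=
  x.1 1 0 * p ^ 2 + (x.1 1 1 - x.1 0 0) * (p * q) - x.1 0 1 * q ^ 2

/-- For `u = (p, q)` the form is `det(u, x u)`, and `det(g u, g x u) = det(u, x u)` because `det g =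
1`. -/
theorem eigenForm_conj {L : Type*} [Field L] (g x : SL(2, L)) (p q : L) :
    eigenForm (g * x * g⁻¹) (g.1 0 0 * p + g.1 0 1 * q) (g.1 1 0 * p + g.1 1 1 * q) =
      eigenForm x p q := by
  have h := g.2
  rw [Matrix.det_fin_two] at h
  simp only [eigenForm, Matrix.SpecialLinearGroup.coe_mul, Matrix.SpecialLinearGroup.coe_inv,
    Matrix.adjugate_fin_two,
    Matrix.mul_apply, Fin.sum_univ_two, Matrix.of_apply, Matrix.cons_val_zero,
    Matrix.cons_val_one]
  linear_combination (g.1 0 0 * g.1 1 1 - g.1 0 1 * g.1 1 0 + 1) *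
    (x.1 1 0 * p ^ 2 + (x.1 1 1 - x.1 0 0) * (p * q) - x.1 0 1 * q ^ 2) * h

theorem exists_eigenForm_eq_zero {L : Type*} [Field L] [IsAlgClosed L] (x : SL(2, L)) :
    ∃ p q : L, (p ≠ 0 ∨ q ≠ 0) ∧ eigenForm x p q = 0 := by
  by_cases hc : x.1 1 0 = 0
  · exact ⟨1, 0, by simp, by simp [eigenForm, hc]⟩
  · obtain ⟨z, hz⟩ := IsAlgClosed.exists_root
      (Polynomial.C (x.1 1 0) * Polynomial.X ^ 2 +
        Polynomial.C (x.1 1 1 - x.1 0 0) * Polynomial.X + Polynomial.C (-x.1 0 1))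
      (by rw [Polynomial.degree_quadratic hc]; decide)
    refine ⟨z, 1, by simp, ?_⟩
    simp only [Polynomial.IsRoot.def, Polynomial.eval_add, Polynomial.eval_mul,
      Polynomial.eval_C, Polynomial.eval_pow, Polynomial.eval_X] at hz
    rw [eigenForm]
    linear_combination hz

/-- An element of `SL₂` with three fixed points in the affine line is trivial. -/
theorem eq_one_of_three_eigenForm {L : Type*} [Field L] [CharP L 2] {x : SL(2, L)} {z₁ z₂ z₃ : L}
    (h₁ : eigenForm x z₁ 1 = 0) (h₂ : eigenForm x z₂ 1 = 0) (h₃ : eigenForm x z₃ 1 = 0)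
    (h₁₂ : z₁ - z₂ ≠ 0) (h₁₃ : z₁ - z₃ ≠ 0) (h₂₃ : z₂ - z₃ ≠ 0) : x = 1 := by
  simp only [eigenForm] at h₁ h₂ h₃
  have e₁ : x.1 1 0 * (z₁ + z₂) + (x.1 1 1 - x.1 0 0) = 0 :=
    mul_left_cancel₀ h₁₂ (by linear_combination h₁ - h₂)
  have e₂ : x.1 1 0 * (z₁ + z₃) + (x.1 1 1 - x.1 0 0) = 0 :=
    mul_left_cancel₀ h₁₃ (by linear_combination h₁ - h₃)
  have hc : x.1 1 0 = 0 := mul_left_cancel₀ h₂₃ (by linear_combination e₁ - e₂)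
  rw [hc] at e₁ h₁
  have hd : x.1 1 1 - x.1 0 0 = 0 := by linear_combination e₁
  rw [hd] at h₁
  exact SL2_eq_one_of_scalar (by linear_combination -h₁) hc (sub_eq_zero.1 hd).symm

section Valuation

variable {L : Type*} [Field L] {Γ : Type*} [LinearOrderedCommGroupWithZero Γ] (v : Valuation L Γ)

/-- The elements of `SL₂` fixing a point of the residue disc of `a`. -/
def fixesNear (a : L) : Set SL(2, L) :=
  {x | ∃ p q, v (p - a * q) < v q ∧ eigenForm x p q = 0}

/-- The elements of `SL₂` fixing a point of the residue disc at infinity. -/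
def fixesNearInfty : Set SL(2, L) :=
  {x | ∃ p q, v q < v p ∧ eigenForm x p q = 0}

theorem exists_of_mem_fixesNear {a : L} {x : SL(2, L)} (h : x ∈ fixesNear v a) :
    ∃ z, v (z - a) < 1 ∧ eigenForm x z 1 = 0 := by
  obtain ⟨p, q, hpq, hx⟩ := h
  have hq : q ≠ 0 := by
    rintro rfl
    simp at hpq
  have hvq : 0 < v q := zero_lt_iff.2 (v.ne_zero_iff.2 hq)
  refine ⟨p / q, ?_, ?_⟩
  · have : p / q - a = (p - a * q) / q := by field_simp
    rwa [this, map_div₀, div_lt_one₀ hvq]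
  · have : eigenForm x (p / q) 1 * q ^ 2 = eigenForm x p q := by
      simp only [eigenForm]
      field_simp
    rw [hx] at this
    exact (mul_eq_zero.1 this).resolve_right (pow_ne_zero 2 hq)

/-- By the ultrametric inequality, discs around points at distance one are disjoint. -/
theorem sub_ne_zero_of_mem_discs {a b z w : L} (hab : v (a - b) = 1) (hz : v (z - a) < 1)
    (hw : v (w - b) < 1) : z - w ≠ 0 := by
  intro h
  have : a - b = (w - b) - (z - a) := by linear_combination h
  exact (v.map_sub_lt hw hz).ne (this ▸ hab)

theorem eq_one_of_mem_three_fixesNear [CharP L 2] {a b c : L} (hab : v (a - b) = 1)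
    (hac : v (a - c) = 1) (hbc : v (b - c) = 1) {x : SL(2, L)} (ha : x ∈ fixesNear v a)
    (hb : x ∈ fixesNear v b) (hc : x ∈ fixesNear v c) : x = 1 := by
  obtain ⟨z₁, h₁, e₁⟩ := exists_of_mem_fixesNear v ha
  obtain ⟨z₂, h₂, e₂⟩ := exists_of_mem_fixesNear v hb
  obtain ⟨z₃, h₃, e₃⟩ := exists_of_mem_fixesNear v hc
  exact eq_one_of_three_eigenForm e₁ e₂ e₃ (sub_ne_zero_of_mem_discs v hab h₁ h₂)
    (sub_ne_zero_of_mem_discs v hac h₁ h₃) (sub_ne_zero_of_mem_discs v hbc h₂ h₃)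

theorem upperUnipotent_conj_mem_fixesNear {a : L} {x : SL(2, L)} (hx : x ∈ fixesNear v 0) :
    upperUnipotent a * x * (upperUnipotent a)⁻¹ ∈ fixesNear v a := by
  obtain ⟨p, q, hpq, h⟩ := hx
  rw [← eigenForm_conj (upperUnipotent a)] at h
  refine ⟨_, _, ?_, h⟩
  simpa using hpq

/-- The translation by an integral `a` preserves the disc at infinity. -/
theorem upperUnipotent_conj_mem_fixesNearInfty {a : L} (ha : v a ≤ 1) {x : SL(2, L)}
    (hx : x ∈ fixesNearInfty v) :
    upperUnipotent a * x * (upperUnipotent a)⁻¹ ∈ fixesNearInfty v := by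
  obtain ⟨p, q, hpq, h⟩ := hx
  rw [← eigenForm_conj (upperUnipotent a)] at h
  refine ⟨_, _, ?_, h⟩
  have : v (a * q) < v p := by
    rw [map_mul]
    exact (mul_le_of_le_one_left' ha).trans_lt hpq
  simpa [v.map_add_eq_of_lt_left this] using hpq

variable {ν : Set SL(2, L) → ℝ≥0} (hν : ConjMean ν)
include hν

/-- Conjugation by a hyperbolic diagonal matrix shows that almost all elements fix a point near
`0` or near infinity. -/
theorem ConjMean.fixesNearInfty_union_fixesNear_zero [IsAlgClosed L] {t : L} (ht : 1 < v t) :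
    ν (fixesNearInfty v ∪ fixesNear v 0) = 1 := by
  have ht0 : t ≠ 0 := by
    rintro rfl
    simp at ht
  -- `S` requires all fixed points to lie near infinity, which makes it disjoint from `fixesNear v
  -- 0`, so that additivity applies.
  let S : Set SL(2, L) := {x | ∀ p q, (p ≠ 0 ∨ q ≠ 0) → eigenForm x p q = 0 → v q < v p}
  have hS : S ⊆ fixesNearInfty v := by
    intro x hx
    obtain ⟨p, q, hpq, h⟩ := exists_eigenForm_eq_zero x
    exact ⟨p, q, hx p q hpq h, h⟩
  have hdisj : Disjoint S (fixesNear v 0) := by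
    rw [Set.disjoint_left]
    rintro x hx ⟨p, q, hpq, h⟩
    rw [zero_mul, sub_zero] at hpq
    have hq : q ≠ 0 := by
      rintro rfl
      simp at hpq
    exact (hx p q (.inr hq) h).not_gt hpq
  let g : SL(2, L) := ⟨!![t, 0; 0, t⁻¹], by simp [ht0]⟩
  have hg : (g : Matrix (Fin 2) (Fin 2) L) = !![t, 0; 0, t⁻¹] := rfl
  -- The matrix `g` acts as multiplication by `t²`, sending every point with `v z ≥ 1` into the disc
  -- at infinity.
  have hle : ν (fixesNear v 0)ᶜ ≤ ν S := by
    refine hν.le_of_conj g fun x hx p q hpq h => ?_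
    have h' : eigenForm x (t⁻¹ * p) (t * q) = 0 := by
      rw [← eigenForm_conj g]
      simpa [hg, ht0] using h
    have h1 : v t * v q ≤ (v t)⁻¹ * v p := by
      rw [← map_inv₀, ← map_mul, ← map_mul]
      refine not_lt.1 fun hlt => hx ⟨_, _, ?_, h'⟩
      simpa using hlt
    have htpos : 0 < v t := zero_lt_one.trans ht
    rw [inv_mul_eq_div, le_div_iff₀ htpos] at h1
    by_cases hq : q = 0
    · subst hq
      simpa [zero_lt_iff] using hpq
    · have hvq : 0 < v q := zero_lt_iff.2 (v.ne_zero_iff.2 hq)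
      calc v q < v t * v q := lt_mul_of_one_lt_left hvq ht
        _ < v t * v q * v t := lt_mul_of_one_lt_right (mul_pos htpos hvq) ht
        _ ≤ v p := h1
  have h1 : ν (S ∪ fixesNear v 0) = 1 := by
    refine le_antisymm (hν.le_one _) ?_
    rw [hν.union _ _ hdisj, ← hν.compl (fixesNear v 0), add_comm]
    exact add_le_add_left hle _
  exact hν.eq_one_of_subset h1 (union_subset_union_left _ hS)

/-- A conjugation-invariant mean on `SL₂` cannot exist in presence of a valuation that is
nontrivial and whose residue field has more than two elements. -/
theorem ConjMean.false_of_valuation [IsAlgClosed L] [CharP L 2] {t : L} (ht : 1 < v t) : False := by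
  -- A primitive cube root of unity: `0`, `1`, `ω` differ pairwise by units of the valuation ring.
  obtain ⟨ω, hω⟩ : ∃ ω : L, ω ^ 2 + ω + 1 = 0 := by
    obtain ⟨z, hz⟩ := IsAlgClosed.exists_root
      (Polynomial.C (1 : L) * Polynomial.X ^ 2 + Polynomial.C 1 * Polynomial.X + Polynomial.C 1)
      (by rw [Polynomial.degree_quadratic one_ne_zero]; decide)
    exact ⟨z, by simpa using hz⟩
  have hvω : v ω = 1 := by
    have : v ω ^ 3 = 1 := by
      rw [← map_pow, show ω ^ 3 = 1 by linear_combination (ω - 1) * hω, map_one]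
    exact (pow_eq_one_iff_of_nonneg zero_le three_ne_zero).1 this
  have hvω' : v (1 - ω) = 1 := by
    have h2 : (2 : L) = 0 := CharTwo.two_eq_zero
    rw [show 1 - ω = ω ^ 2 by linear_combination h2 - hω, map_pow, hvω, one_pow]
  have h3 : ∀ x, x ∈ fixesNear v 0 → x ∈ fixesNear v 1 → x ∈ fixesNear v ω → x = 1 :=
    fun x => eq_one_of_mem_three_fixesNear v (by simp) (by simpa using hvω) hvω'
  have hU : ∀ a, v a ≤ 1 → ν (fixesNearInfty v ∪ fixesNear v a) = 1 := fun a ha =>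
    hν.eq_one_of_conj (upperUnipotent a) (hν.fixesNearInfty_union_fixesNear_zero v ht) fun x hx =>
      hx.imp (upperUnipotent_conj_mem_fixesNearInfty v ha) (upperUnipotent_conj_mem_fixesNear v)
  have hInf : ν (fixesNearInfty v) = 1 := by
    refine hν.eq_one_of_union_one (hν.eq_one_of_subset (hν.inter (hν.inter (hU 0 (by simp))
      (hU 1 (by simp))) (hU ω hvω.le)) ?_)
    rintro x ⟨⟨h0 | h0, h1 | h1⟩, h2 | h2⟩
    all_goals first | exact .inl ‹_› | exact .inr (h3 x h0 h1 h2)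
  -- The Weyl element exchanges the discs at infinity and at `0`.
  let w : SL(2, L) := ⟨!![0, 1; -1, 0], by simp⟩
  have hw : (w : Matrix (Fin 2) (Fin 2) L) = !![0, 1; -1, 0] := rfl
  have h0 : ν (fixesNear v 0) = 1 := by
    refine hν.eq_one_of_conj w hInf ?_
    rintro x ⟨p, q, hpq, h⟩
    rw [← eigenForm_conj w] at h
    refine ⟨_, _, ?_, h⟩
    simpa [hw] using hpq
  have hN : ∀ a, ν (fixesNear v a) = 1 := fun a =>
    hν.eq_one_of_conj (upperUnipotent a) h0 fun x => upperUnipotent_conj_mem_fixesNear v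
  have : ν {1} = 1 := hν.eq_one_of_subset (hν.inter (hν.inter (hN 0) (hN 1)) (hN ω))
    fun x hx => h3 x hx.1.1 hx.1.2 hx.2
  rw [hν.one] at this
  exact zero_ne_one this

end Valuation

/-- A field that is transcendental over a subfield carries a valuation of which some element has
value larger than one. -/
theorem exists_one_lt_valuation (F L : Type*) [Field F] [Field L] [Algebra F L]
    [h : Algebra.Transcendental F L] :
    ∃ (V : ValuationSubring L) (t : L), 1 < V.valuation t := by
  obtain ⟨t, ht⟩ := h.transcendental
  -- An integrally closed subring is an intersection of valuation rings, so one of them omits the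
  -- transcendental `t`.
  let R : Subring L := (integralClosure F L).toSubring
  have hR : t ∉ R := fun h => ht (isAlgebraic_iff_isIntegral.2 h)
  have : IsIntegrallyClosedIn R L :=
    inferInstanceAs (IsIntegrallyClosedIn (integralClosure F L) L)
  obtain ⟨V, -, hV⟩ := Subring.exists_le_valuationSubring_of_isIntegrallyClosedIn hR
  exact ⟨V, t, not_le.1 fun h => hV ((V.valuation_le_one_iff t).1 h)⟩

theorem not_isInnerAmenable_SL2 (F L : Type*) [Field F] [Field L] [Algebra F L] [IsAlgClosed L]
    [CharP L 2] [Algebra.Transcendental F L] : ¬ IsInnerAmenable SL(2, L) := by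
  intro h
  obtain ⟨ν, hν⟩ := h.exists_conjMean
  obtain ⟨V, t, ht⟩ := exists_one_lt_valuation F L
  exact hν.false_of_valuation V.valuation ht

/-! ### Countability -/

theorem countable_SL2 (R : Type*) [CommRing R] [Countable R] : Countable SL(2, R) :=
  have : Countable (Matrix (Fin 2) (Fin 2) R) := inferInstanceAs (Countable (Fin 2 → Fin 2 → R))
  Subtype.countable

theorem countable_of_isAlgebraic (F K : Type*) [Field F] [Countable F] [Field K] [Algebra F K]
    [Algebra.IsAlgebraic F K] : Countable K := by
  rw [← Cardinal.mk_le_aleph0_iff, ← Cardinal.lift_le_aleph0]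
  refine (Algebra.IsAlgebraic.lift_cardinalMk_le_max F K).trans ?_
  simp

theorem theorem1 :
    -- There are elementarily equivalent countable ICC groups, one amenable, one not inner amenable.
    (∃ (G H : Type) (_ : Group G) (_ : Group H),
      Countable G ∧ Countable H ∧ IsICC G ∧ IsICC H ∧
      (G ≅[groupLanguage] H) ∧ IsAmenable G ∧ ¬ IsInnerAmenable H) ∧
    -- Concretely, one may take `G = SL₂(K)` with `K` the algebraic closure of `𝔽₂`, ...
    (Countable SL(2, AlgebraicClosure (ZMod 2)) ∧ IsICC SL(2, AlgebraicClosure (ZMod 2)) ∧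
      IsAmenable SL(2, AlgebraicClosure (ZMod 2))) ∧
    -- ... and `H = SL₂(L)` with `L` algebraically closed of characteristic 2 and positive
    -- transcendence degree (over the prime field), countable if `H` is to be countable, ...
    (∀ (L : Type*) [Field L] [IsAlgClosed L] [CharP L 2] [Algebra (ZMod 2) L],
      0 < Algebra.trdeg (ZMod 2) L →
        (Countable L → Countable SL(2, L)) ∧ IsICC SL(2, L) ∧
        (SL(2, AlgebraicClosure (ZMod 2)) ≅[groupLanguage] SL(2, L)) ∧
        ¬ IsInnerAmenable SL(2, L)) ∧
    -- ... for example `L` the algebraic closure of `𝔽₂(t)`.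
    (Countable (AlgebraicClosure (RatFunc (ZMod 2))) ∧
      IsAlgClosed (AlgebraicClosure (RatFunc (ZMod 2))) ∧
      CharP (AlgebraicClosure (RatFunc (ZMod 2))) 2 ∧
      0 < Algebra.trdeg (ZMod 2) (AlgebraicClosure (RatFunc (ZMod 2)))) := by
  have hK := countable_of_isAlgebraic (ZMod 2) (AlgebraicClosure (ZMod 2))
  have hKc : CharP (AlgebraicClosure (ZMod 2)) 2 := inferInstance
  have hRat : Countable (RatFunc (ZMod 2)) := by
    rw [← Cardinal.mk_le_aleph0_iff, IsFractionRing.cardinalMk (Polynomial (ZMod 2))]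
    simp
  have hL := countable_of_isAlgebraic (RatFunc (ZMod 2)) (AlgebraicClosure (RatFunc (ZMod 2)))
  have hLc : CharP (AlgebraicClosure (RatFunc (ZMod 2))) 2 := inferInstance
  have hLt : 0 < Algebra.trdeg (ZMod 2) (AlgebraicClosure (RatFunc (ZMod 2))) := by
    have : Algebra.Transcendental (ZMod 2) (AlgebraicClosure (RatFunc (ZMod 2))) :=
      ⟨algebraMap (RatFunc (ZMod 2)) _ RatFunc.X,
        (transcendental_algebraMap_iff (FaithfulSMul.algebraMap_injective _ _)).2
          RatFunc.transcendental_X⟩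
    exact trdeg_pos _ _
  have hGK := isICC_SL2 (AlgebraicClosure (ZMod 2))
  have hAK := isAmenable_SL2_of_isAlgebraic (ZMod 2) (AlgebraicClosure (ZMod 2))
  have hnot : ¬ IsInnerAmenable SL(2, AlgebraicClosure (RatFunc (ZMod 2))) := by
    have := trdeg_ne_zero_iff.1 hLt.ne'
    exact not_isInnerAmenable_SL2 (ZMod 2) _
  refine ⟨⟨SL(2, AlgebraicClosure (ZMod 2)), SL(2, AlgebraicClosure (RatFunc (ZMod 2))),
    inferInstance, inferInstance, countable_SL2 _, countable_SL2 _, hGK, isICC_SL2 _,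
    elementarilyEquivalent_SL2 2 _ _, hAK, hnot⟩, ⟨countable_SL2 _, hGK, hAK⟩, ?_,
    hL, inferInstance, hLc, hLt⟩
  intro L _ _ _ _ hL
  have := trdeg_ne_zero_iff.1 hL.ne'
  exact ⟨fun _ => countable_SL2 L, isICC_SL2 L, elementarilyEquivalent_SL2 2 _ L,
    not_isInnerAmenable_SL2 (ZMod 2) L⟩
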